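/- For a finite simple graph $G$, let $s^+(G)$ (respectively $s^-(G)$) denote the sum of the squares of the positive (respectively negative) eigenvalues of the adjacency matrix of $G$, counted with multiplicity. The Kneser graph $K(n,k)$ has as vertices the $k$-element subsets of $\{1,\dots,n\}$, and two vertices are adjacent if and only if they are disjoint. \textbf{Theorem.} Let $k \ge 2$ and $1 \le j < k$ be integers. Then the Kneser graph $K(2k+2j,k)$ is not bipartite and satisfies \[ s^+\bigl(K(2k+2j,k)\bigr) \;=\; s^-\bigl(K(2k+2j,k)\bigr) \;=\; \frac12\binom{2k+2j}{k}\binom{k+2j}{k}. \] In particular, there are infinitely many pairwise non-isomorphic non-bipartite graphs $G$ with $s^+(G)=s^-(G)$; they can be chosen among the graphs $K(2k+2j,k)$ with $1\le j<k$. -/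

import Mathlib

/-- The adjacency matrix of a finite graph, with real entries, is Hermitian. -/
theorem SimpleGraph.isHermitian_adjMatrix_real {V : Type*} (G : SimpleGraph V)
    [DecidableRel G.Adj] : (G.adjMatrix ℝ).IsHermitian := by
  rw [Matrix.IsHermitian, Matrix.conjTranspose_eq_transpose_of_trivial]
  exact SimpleGraph.transpose_adjMatrix G

/-- The positive square energy of a finite graph: the sum of the squares of the positive
eigenvalues of its adjacency matrix, counted with multiplicity. -/
noncomputable def SimpleGraph.posSquareEnergy {V : Type*} [Fintype V] [DecidableEq V]
    (G : SimpleGraph V) [DecidableRel G.Adj] : ℝ :=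
  ∑ v : V with 0 < G.isHermitian_adjMatrix_real.eigenvalues v,
    G.isHermitian_adjMatrix_real.eigenvalues v ^ 2

/-- The negative square energy of a finite graph: the sum of the squares of the negative
eigenvalues of its adjacency matrix, counted with multiplicity. -/
noncomputable def SimpleGraph.negSquareEnergy {V : Type*} [Fintype V] [DecidableEq V]
    (G : SimpleGraph V) [DecidableRel G.Adj] : ℝ :=
  ∑ v : V with G.isHermitian_adjMatrix_real.eigenvalues v < 0,
    G.isHermitian_adjMatrix_real.eigenvalues v ^ 2

/-- The Kneser graph `K(n, k)`: the vertices are the `k`-element subsets of an `n`-element set,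
and two vertices are adjacent when they are disjoint. (The condition `A ≠ B` follows from
disjointness unless `k = 0`; it excludes a loop in that case.) -/
def kneserGraph (n k : ℕ) : SimpleGraph {A : Finset (Fin n) // A.card = k} where
  Adj A B := A ≠ B ∧ Disjoint A.1 B.1
  symm := ⟨fun _ _ h => ⟨h.1.symm, h.2.symm⟩⟩
  loopless := ⟨fun _ h => h.1 rfl⟩

instance kneserGraph.decidableRelAdj (n k : ℕ) : DecidableRel (kneserGraph n k).Adj :=
  fun A B => inferInstanceAs (Decidable (A ≠ B ∧ Disjoint A.1 B.1))

/-! ### Spectral calculus for real Hermitian matrices. -/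

namespace Matrix

variable {V : Type*} [Fintype V] [DecidableEq V]

/-! With `A` the adjacency matrix, s⁺ + s⁻ = tr A² is the degree sum and s⁺ - s⁻ = tr(A|A|), so it
suffices that the latter trace vanishes. Put h = k + j, so n = 2h, and let W, W' be the inclusion
and disjointness matrices of k-sets against h-sets. Then WᵀW' = cA with c > 0, and WWᵀ = W'W'ᵀ.
Hence (WᵀW)² = WᵀW'W'ᵀW = (cA)², and uniqueness of the positive semidefinite square root gives |A| =
c⁻¹WᵀW. Since h < 2k, no h-set contains two disjoint k-sets, so |A| vanishes on every edge and
tr(A|A|) = 0. -/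

theorem conj_diagonal_mul_conj_diagonal {U : Matrix V V ℝ} (hU : Uᴴ * U = 1) (D E : V → ℝ) :
    (U * diagonal D * Uᴴ) * (U * diagonal E * Uᴴ) = U * diagonal (fun v => D v * E v) * Uᴴ := by
  rw [← diagonal_mul_diagonal]
  calc _ = U * diagonal D * (Uᴴ * U) * diagonal E * Uᴴ := by simp only [Matrix.mul_assoc]
    _ = _ := by rw [hU]; simp only [Matrix.mul_assoc, Matrix.one_mul]

theorem trace_conj_diagonal {U : Matrix V V ℝ} (hU : Uᴴ * U = 1) (D : V → ℝ) :
    (U * diagonal D * Uᴴ).trace = ∑ v, D v := by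
  rw [trace_mul_comm, ← Matrix.mul_assoc, hU, Matrix.one_mul, trace_diagonal]

theorem IsHermitian.exists_eq_conj_diagonal {A : Matrix V V ℝ} (hA : A.IsHermitian) :
    ∃ U : Matrix V V ℝ, Uᴴ * U = 1 ∧ A = U * diagonal hA.eigenvalues * Uᴴ := by
  refine ⟨hA.eigenvectorUnitary, Unitary.coe_star_mul_self hA.eigenvectorUnitary, ?_⟩
  conv_lhs => rw [hA.spectral_theorem, Unitary.conjStarAlgAut_apply]
  rfl

open scoped MatrixOrder Matrix.Norms.L2Operator in
/-- If `P` is the absolute value of the Hermitian matrix `A`, then the trace of `A * P` is the sum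
of `λ * |λ|` over the eigenvalues `λ` of `A`. -/
theorem IsHermitian.trace_mul_eq_sum_mul_abs {A P : Matrix V V ℝ} (hA : A.IsHermitian)
    (hP : P.PosSemidef) (h : P * P = A * A) :
    (A * P).trace = ∑ v, hA.eigenvalues v * |hA.eigenvalues v| := by
  obtain ⟨U, hU, hAU⟩ := hA.exists_eq_conj_diagonal
  have hQ : (U * diagonal (fun v => |hA.eigenvalues v|) * Uᴴ).PosSemidef :=
    (PosSemidef.diagonal fun v => abs_nonneg _).mul_mul_conjTranspose_same U
  have hPQ : P = U * diagonal (fun v => |hA.eigenvalues v|) * Uᴴ := by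
    -- Both sides are positive semidefinite square roots of A².
    rw [← CFC.sqrt_unique h hP.nonneg]
    refine CFC.sqrt_unique ?_ hQ.nonneg
    rw [congrArg₂ (· * ·) hAU hAU]
    simp only [conj_diagonal_mul_conj_diagonal hU, abs_mul_abs_self]
  rw [congrArg₂ (· * ·) hAU hPQ, conj_diagonal_mul_conj_diagonal hU, trace_conj_diagonal hU]

theorem IsHermitian.trace_mul_self_eq_sum_sq {A : Matrix V V ℝ} (hA : A.IsHermitian) :
    (A * A).trace = ∑ v, hA.eigenvalues v ^ 2 := by
  obtain ⟨U, hU, hAU⟩ := hA.exists_eq_conj_diagonal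
  rw [congrArg₂ (· * ·) hAU hAU, conj_diagonal_mul_conj_diagonal hU, trace_conj_diagonal hU]
  simp only [sq]

end Matrix

/-! ### Sum and difference of the square energies as traces. -/

namespace SimpleGraph

variable {V : Type*} [Fintype V] [DecidableEq V] (G : SimpleGraph V) [DecidableRel G.Adj]

theorem posSquareEnergy_add_negSquareEnergy :
    G.posSquareEnergy + G.negSquareEnergy = ∑ v, (G.degree v : ℝ) := by
  have h := G.isHermitian_adjMatrix_real.trace_mul_self_eq_sum_sq
  rw [Matrix.trace] at h
  simp only [Matrix.diag_apply, adjMatrix_mul_self_apply_self] at h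
  rw [h, posSquareEnergy, negSquareEnergy, Finset.sum_filter, Finset.sum_filter,
    ← Finset.sum_add_distrib]
  refine Finset.sum_congr rfl fun v _ => ?_
  rcases lt_trichotomy (G.isHermitian_adjMatrix_real.eigenvalues v) 0 with h | h | h
  · simp [h, h.le]
  · simp [h]
  · simp [h, h.le]

theorem posSquareEnergy_sub_negSquareEnergy {P : Matrix V V ℝ} (hP : P.PosSemidef)
    (h : P * P = G.adjMatrix ℝ * G.adjMatrix ℝ) :
    G.posSquareEnergy - G.negSquareEnergy = (G.adjMatrix ℝ * P).trace := by
  rw [G.isHermitian_adjMatrix_real.trace_mul_eq_sum_mul_abs hP h, posSquareEnergy,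
    negSquareEnergy, Finset.sum_filter, Finset.sum_filter, ← Finset.sum_sub_distrib]
  refine Finset.sum_congr rfl fun v _ => ?_
  rcases lt_trichotomy (G.isHermitian_adjMatrix_real.eigenvalues v) 0 with h | h | h
  · simp [h, h.le, abs_of_neg, sq]
  · simp [h]
  · simp [h, h.le, abs_of_pos, sq]

end SimpleGraph

/-! ### Counting in Kneser graphs. -/

namespace kneserGraph

open Finset

theorem card_filter_subtype_card {n : ℕ} (k : ℕ) (p : Finset (Fin n) → Prop) [DecidablePred p] :
    #{A : {A : Finset (Fin n) // A.card = k} | p A.1} = #{A ∈ powersetCard k univ | p A} := by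
  refine card_nbij Subtype.val ?_ Subtype.val_injective.injOn ?_
  · intro A hA
    simpa [A.2] using hA
  · intro A hA
    simp only [coe_filter, mem_powersetCard, Set.mem_ofPred_eq] at hA
    exact ⟨⟨A, hA.1.2⟩, by simpa using hA.2, rfl⟩

theorem card_filter_subset {n : ℕ} (k : ℕ) (T : Finset (Fin n)) :
    #{A : {A : Finset (Fin n) // A.card = k} | A.1 ⊆ T} = (#T).choose k := by
  rw [card_filter_subtype_card k (· ⊆ T), ← card_powersetCard]
  congr 1
  ext A
  simp [and_comm]

theorem card_filter_subset_subset {n k : ℕ} {A T : Finset (Fin n)} (hAT : A ⊆ T) (hk : #A ≤ k) :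
    #{H : {H : Finset (Fin n) // H.card = k} | A ⊆ H.1 ∧ H.1 ⊆ T} =
      (#T - #A).choose (k - #A) := by
  rw [card_filter_subtype_card k (fun H => A ⊆ H ∧ H ⊆ T), ← card_sdiff_of_subset hAT,
    ← card_powersetCard]
  refine card_nbij' (· \ A) (· ∪ A) ?_ ?_ ?_ ?_
  · intro H hH
    simp only [coe_filter, mem_powersetCard, Set.mem_ofPred_eq, mem_coe] at hH ⊢
    exact ⟨sdiff_subset_sdiff hH.2.2 le_rfl, by rw [card_sdiff_of_subset hH.2.1, hH.1.2]⟩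
  · intro S hS
    simp only [coe_filter, mem_powersetCard, Set.mem_ofPred_eq, mem_coe, subset_sdiff] at hS ⊢
    refine ⟨⟨subset_univ _, ?_⟩, subset_union_right, union_subset hS.1.1 hAT⟩
    rw [card_union_of_disjoint hS.1.2, hS.2]
    omega
  · intro H hH
    simp only [coe_filter, Set.mem_ofPred_eq] at hH
    exact sdiff_union_of_subset hH.2.1
  · intro S hS
    simp only [mem_powersetCard, mem_coe, subset_sdiff] at hS
    exact union_sdiff_cancel_right hS.1.2

theorem adj_iff_disjoint {n k : ℕ} (hk : k ≠ 0) (A B : {A : Finset (Fin n) // A.card = k}) :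
    (kneserGraph n k).Adj A B ↔ Disjoint A.1 B.1 := by
  refine ⟨fun h => h.2, fun h => ⟨?_, h⟩⟩
  rintro rfl
  rw [disjoint_self, bot_eq_empty] at h
  exact hk (by rw [← A.2, h, card_empty])

theorem degree_eq {n k : ℕ} (hk : k ≠ 0) (A : {A : Finset (Fin n) // A.card = k}) :
    (kneserGraph n k).degree A = (n - k).choose k := by
  have h := card_filter_subset k (A.1ᶜ)
  rw [card_compl, A.2, Fintype.card_fin] at h
  rw [← h, ← SimpleGraph.card_neighborFinset_eq_degree]
  congr 1
  ext B
  simp only [SimpleGraph.mem_neighborFinset, adj_iff_disjoint hk, mem_filter, mem_univ, true_and,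
    subset_compl_iff_disjoint_left]

theorem card_vertices (n k : ℕ) :
    Fintype.card {A : Finset (Fin n) // A.card = k} = n.choose k := by
  simp

/-! ### Inclusion and disjointness matrices. -/

theorem sum_ite_mul_ite {ι : Type*} [Fintype ι] (p q : ι → Prop) [DecidablePred p]
    [DecidablePred q] :
    ∑ x, (if p x then (1 : ℝ) else 0) * (if q x then 1 else 0) = #{x | p x ∧ q x} := by
  rw [card_filter, Nat.cast_sum]
  refine sum_congr rfl fun x _ => ?_
  split_ifs <;> simp_all

/-- The inclusion matrix between `k`-subsets and `h`-subsets of an `n`-set. -/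
def inclusionMatrix (n h k : ℕ) :
    Matrix {A : Finset (Fin n) // A.card = h} {A : Finset (Fin n) // A.card = k} ℝ :=
  Matrix.of fun H A => if A.1 ⊆ H.1 then 1 else 0

/-- The disjointness matrix between `k`-subsets and `h`-subsets of an `n`-set. -/
def disjointnessMatrix (n h k : ℕ) :
    Matrix {A : Finset (Fin n) // A.card = h} {A : Finset (Fin n) // A.card = k} ℝ :=
  Matrix.of fun H A => if Disjoint H.1 A.1 then 1 else 0

open scoped Matrix

/-- The entry at (A, B) counts the h-sets between A and the complement of B; there are none when A
meets B. -/
theorem inclusionMatrix_transpose_mul_disjointnessMatrix {n h k : ℕ} (hk : k ≠ 0) (hkh : k ≤ h) :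
    (inclusionMatrix n h k)ᵀ * disjointnessMatrix n h k =
      ((n - 2 * k).choose (h - k) : ℝ) • (kneserGraph n k).adjMatrix ℝ := by
  ext A B
  simp only [Matrix.mul_apply, Matrix.transpose_apply, inclusionMatrix, disjointnessMatrix,
    Matrix.of_apply, Matrix.smul_apply, SimpleGraph.adjMatrix_apply, adj_iff_disjoint hk,
    smul_eq_mul, sum_ite_mul_ite]
  split_ifs with hd
  · have := card_filter_subset_subset (k := h) (subset_compl_iff_disjoint_right.2 hd)
      (by rwa [A.2])
    rw [card_compl, A.2, B.2, Fintype.card_fin, Nat.sub_sub, ← two_mul] at this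
    simp only [subset_compl_iff_disjoint_right] at this
    rw [this, mul_one]
  · rw [mul_zero, Nat.cast_eq_zero, card_eq_zero, filter_eq_empty_iff]
    exact fun H _ hH => hd (hH.2.mono_left hH.1)

/-- The entries count k-subsets of H ∩ K and of (H ∪ K)ᶜ. These sets have equal size because H and K
are each half of the ground set. -/
theorem inclusionMatrix_mul_transpose_eq {h k : ℕ} :
    inclusionMatrix (2 * h) h k * (inclusionMatrix (2 * h) h k)ᵀ =
      disjointnessMatrix (2 * h) h k * (disjointnessMatrix (2 * h) h k)ᵀ := by
  ext H K
  simp only [Matrix.mul_apply, Matrix.transpose_apply, inclusionMatrix, disjointnessMatrix,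
    Matrix.of_apply, sum_ite_mul_ite]
  congr 1
  have h₁ := card_filter_subset k (H.1 ∩ K.1)
  have h₂ := card_filter_subset k (H.1 ∪ K.1)ᶜ
  simp only [subset_inter_iff] at h₁
  simp only [subset_compl_iff_disjoint_left, disjoint_union_left] at h₂
  rw [h₁, h₂]
  have := card_union_add_card_inter H.1 K.1
  rw [H.2, K.2] at this
  rw [card_compl, Fintype.card_fin]
  congr 1
  omega

theorem inclusionMatrix_transpose_mul_self_apply {n h k : ℕ} (hhk : h < 2 * k)
    {A B : {A : Finset (Fin n) // A.card = k}} (hd : Disjoint A.1 B.1) :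
    ((inclusionMatrix n h k)ᵀ * inclusionMatrix n h k) A B = 0 := by
  simp only [Matrix.mul_apply, Matrix.transpose_apply, inclusionMatrix,
    Matrix.of_apply, sum_ite_mul_ite]
  rw [Nat.cast_eq_zero, card_eq_zero, filter_eq_empty_iff]
  intro H _ hH
  have := card_le_card (union_subset hH.1 hH.2)
  rw [card_union_of_disjoint hd, A.2, B.2, H.2] at this
  omega

theorem posSquareEnergy_eq_negSquareEnergy {h k : ℕ} (hk : k ≠ 0) (hkh : k ≤ h)
    (hhk : h < 2 * k) :
    (kneserGraph (2 * h) k).posSquareEnergy = (kneserGraph (2 * h) k).negSquareEnergy := by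
  set W := inclusionMatrix (2 * h) h k with hW
  set W' := disjointnessMatrix (2 * h) h k
  set A := (kneserGraph (2 * h) k).adjMatrix ℝ with hA
  set c : ℝ := ((2 * h - 2 * k).choose (h - k) : ℝ) with hc
  have hc0 : 0 < c := by
    rw [hc]
    exact_mod_cast Nat.choose_pos (by omega)
  have hWW' : Wᵀ * W' = c • A := inclusionMatrix_transpose_mul_disjointnessMatrix hk hkh
  have hW'W : W'ᵀ * W = c • A := by
    have := congrArg Matrix.transpose hWW'
    rwa [Matrix.transpose_mul, Matrix.transpose_transpose, Matrix.transpose_smul, hA,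
      SimpleGraph.transpose_adjMatrix] at this
  have hsq : (Wᵀ * W) * (Wᵀ * W) = (c • A) * (c • A) := by
    calc (Wᵀ * W) * (Wᵀ * W) = Wᵀ * (W * Wᵀ) * W := by simp only [Matrix.mul_assoc]
      _ = Wᵀ * (W' * W'ᵀ) * W := by rw [hW, inclusionMatrix_mul_transpose_eq]
      _ = (Wᵀ * W') * (W'ᵀ * W) := by simp only [Matrix.mul_assoc]
      _ = _ := by rw [hWW', hW'W]
  have hP : (c⁻¹ • (Wᵀ * W)).PosSemidef := by
    refine Matrix.PosSemidef.smul ?_ (inv_nonneg.2 hc0.le)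
    simpa only [Matrix.conjTranspose_eq_transpose_of_trivial] using
      Matrix.posSemidef_conjTranspose_mul_self W
  have hPA : (c⁻¹ • (Wᵀ * W)) * (c⁻¹ • (Wᵀ * W)) = A * A := by
    rw [smul_mul_smul_comm, hsq, smul_mul_smul_comm, smul_smul]
    field_simp
    simp
  rw [← sub_eq_zero, SimpleGraph.posSquareEnergy_sub_negSquareEnergy _ hP hPA, Matrix.trace]
  refine sum_eq_zero fun X _ => ?_
  rw [Matrix.diag_apply, Matrix.mul_apply]
  refine sum_eq_zero fun Y _ => ?_
  rw [SimpleGraph.adjMatrix_apply]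
  split_ifs with hXY
  · rw [Matrix.smul_apply, inclusionMatrix_transpose_mul_self_apply hhk hXY.2.symm, smul_zero,
      mul_zero]
  · rw [zero_mul]

theorem posSquareEnergy_add_negSquareEnergy {n k : ℕ} (hk : k ≠ 0) :
    (kneserGraph n k).posSquareEnergy + (kneserGraph n k).negSquareEnergy =
      (n.choose k : ℝ) * ((n - k).choose k : ℝ) := by
  rw [SimpleGraph.posSquareEnergy_add_negSquareEnergy]
  simp only [degree_eq hk, sum_const, card_univ, card_vertices, nsmul_eq_mul]

/-- A `2`-colouring takes the same value on two vertices with a common neighbour. -/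
theorem color_eq_of_card_union_le {n k : ℕ} (hk : k ≠ 0)
    (c : (kneserGraph n k).Coloring (Fin 2)) {A B : {A : Finset (Fin n) // A.card = k}}
    (h : #(A.1 ∪ B.1) + k ≤ n) : c A = c B := by
  obtain ⟨C, hC, hCk⟩ := exists_subset_card_eq (s := (A.1 ∪ B.1)ᶜ) (n := k)
    (by rw [card_compl, Fintype.card_fin]; omega)
  rw [subset_compl_iff_disjoint_left, disjoint_union_left] at hC
  have hA := c.valid ((adj_iff_disjoint hk A ⟨C, hCk⟩).2 hC.1)
  have hB := c.valid ((adj_iff_disjoint hk B ⟨C, hCk⟩).2 hC.2)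
  omega

/-- Exchanging one element of A for one of B moves A closer to B. The old and new sets have a union
of at most k + 1 elements, so 2k < n leaves room for a common neighbour. A 2-colouring is therefore
constant, which any edge contradicts. -/
theorem color_eq {n k : ℕ} (hk : k ≠ 0) (hn : 2 * k < n)
    (c : (kneserGraph n k).Coloring (Fin 2)) (d : ℕ)
    (A B : {A : Finset (Fin n) // A.card = k}) (hd : #(A.1 \ B.1) = d) : c A = c B := by
  induction d generalizing A with
  | zero =>
    have hAB := sdiff_eq_empty_iff_subset.1 (card_eq_zero.1 hd)
    rw [Subtype.ext (eq_of_subset_of_card_le hAB (by rw [A.2, B.2]))]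
  | succ d ih =>
    obtain ⟨a, ha⟩ := card_pos.1 (show 0 < #(A.1 \ B.1) by omega)
    have hBA : #(B.1 \ A.1) = #(A.1 \ B.1) := card_sdiff_comm (by rw [A.2, B.2])
    obtain ⟨b, hb⟩ := card_pos.1 (show 0 < #(B.1 \ A.1) by omega)
    rw [mem_sdiff] at ha hb
    have hcard : #(insert b (A.1.erase a)) = k := by
      rw [card_insert_of_notMem (fun h => hb.2 (mem_of_mem_erase h)), card_erase_of_mem ha.1, A.2]
      omega
    refine (color_eq_of_card_union_le (B := ⟨_, hcard⟩) hk c ?_).trans (ih ⟨_, hcard⟩ ?_)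
    · have : A.1 ∪ insert b (A.1.erase a) ⊆ insert b A.1 := by
        intro x hx
        simp only [mem_union, mem_insert, mem_erase] at hx ⊢
        tauto
      have := (card_le_card this).trans (card_insert_le _ _)
      rw [A.2] at this
      simp only
      omega
    · have : insert b (A.1.erase a) \ B.1 = (A.1 \ B.1).erase a := by
        ext x
        simp only [mem_sdiff, mem_insert, mem_erase]
        grind
      simp only [this]
      rw [card_erase_of_mem (mem_sdiff.2 ha), hd, Nat.add_sub_cancel]

theorem not_isBipartite {n k : ℕ} (hk : k ≠ 0) (hn : 2 * k < n) :
    ¬ (kneserGraph n k).IsBipartite := by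
  rintro ⟨c⟩
  obtain ⟨A, -, hA⟩ := exists_subset_card_eq (s := (univ : Finset (Fin n))) (n := k)
    (by rw [card_univ, Fintype.card_fin]; omega)
  obtain ⟨B, hB, hBk⟩ := exists_subset_card_eq (s := Aᶜ) (n := k)
    (by rw [card_compl, Fintype.card_fin]; omega)
  exact c.valid ((adj_iff_disjoint hk ⟨A, hA⟩ ⟨B, hBk⟩).2 (subset_compl_iff_disjoint_left.1 hB))
    (color_eq hk hn c _ _ _ rfl)

end kneserGraph

/-- These are the vertex counts for j = 1; strict growth makes the graphs pairwise non-isomorphic.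
-/
theorem Nat.strictMono_choose_two_mul_add_two :
    StrictMono fun k : ℕ => (2 * k + 2).choose k := by
  refine strictMono_nat_of_lt_succ fun k => ?_
  have h₁ : (2 * (k + 1) + 2).choose (k + 1) =
      (2 * k + 2).choose k + (2 * k + 2).choose (k + 1) + (2 * k + 3).choose k := by
    rw [show 2 * (k + 1) + 2 = (2 * k + 3) + 1 by ring, Nat.choose_succ_succ,
      show 2 * k + 3 = (2 * k + 2) + 1 by ring, Nat.choose_succ_succ (2 * k + 2) k]
    ring
  have h₂ : 0 < (2 * k + 2).choose (k + 1) := Nat.choose_pos (by omega)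
  simp only [h₁]
  omega

theorem mainTheorem2 :
    (∀ k j : ℕ, 2 ≤ k → 1 ≤ j → j < k →
      (kneserGraph (2 * k + 2 * j) k).posSquareEnergy =
          (kneserGraph (2 * k + 2 * j) k).negSquareEnergy ∧
        (kneserGraph (2 * k + 2 * j) k).posSquareEnergy =
          (1 / 2 : ℝ) * ((2 * k + 2 * j).choose k : ℝ) * ((k + 2 * j).choose k : ℝ) ∧
        (kneserGraph (2 * k + 2 * j) k).negSquareEnergy =
          (1 / 2 : ℝ) * ((2 * k + 2 * j).choose k : ℝ) * ((k + 2 * j).choose k : ℝ) ∧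
        ¬ (kneserGraph (2 * k + 2 * j) k).IsBipartite) ∧
    ∃ n k : ℕ → ℕ,
      (∀ i, ¬ (kneserGraph (n i) (k i)).IsBipartite ∧
        (kneserGraph (n i) (k i)).posSquareEnergy = (kneserGraph (n i) (k i)).negSquareEnergy ∧
        ∃ j : ℕ, 1 ≤ j ∧ j < k i ∧ n i = 2 * k i + 2 * j) ∧
      ∀ i i', i ≠ i' → IsEmpty (kneserGraph (n i) (k i) ≃g kneserGraph (n i') (k i')) := by
  -- The infinite family takes j = 1 and k = i + 2, the shift ensuring j < k.
  refine ⟨fun k j hk hj hjk => ?_, fun i => 2 * (i + 2) + 2 * 1, fun i => i + 2,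
    fun i => ⟨kneserGraph.not_isBipartite (Nat.succ_ne_zero _) ?_, ?_, 1, le_rfl, ?_, rfl⟩,
    fun i i' hii' => ⟨fun e => hii' ?_⟩⟩
  · have heq := kneserGraph.posSquareEnergy_eq_negSquareEnergy (h := k + j) (k := k)
      (by omega) (by omega) (by omega)
    rw [mul_add] at heq
    have hadd := kneserGraph.posSquareEnergy_add_negSquareEnergy (n := 2 * k + 2 * j) (k := k)
      (by omega)
    rw [show 2 * k + 2 * j - k = k + 2 * j by omega] at hadd
    exact ⟨heq, by linarith, by linarith, kneserGraph.not_isBipartite (by omega) (by omega)⟩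
  · exact Nat.lt_add_of_pos_right Nat.two_pos
  · have heq := kneserGraph.posSquareEnergy_eq_negSquareEnergy (h := i + 2 + 1) (k := i + 2)
      (by omega) (by omega) (by omega)
    rwa [mul_add] at heq
  · exact Nat.lt_add_left i Nat.one_lt_two
  · have h := Fintype.card_congr e.toEquiv
    rw [kneserGraph.card_vertices, kneserGraph.card_vertices] at h
    exact Nat.add_right_cancel (Nat.strictMono_choose_two_mul_add_two.injective h)
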